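/- Let $X_1,\dots,X_m$ be jointly Gaussian real random variables with covariance matrix $\Sigma$. Their Wyner common information is $$C(X^m)=\inf_{P_{U|X^m}} I(U;X^m)\in[0,\infty],$$ where the infimum is over all random transformations $P_{U|X^m}$ (with arbitrary alphabet for $U$) such that $X_1,\dots,X_m$ are conditionally independent given $U$. If $\Sigma\succ 0$, then $$C(X^m)=\frac12\inf_{\Lambda}\log\frac{|\Sigma|}{|\Lambda|},$$ where the infimum is over all diagonal matrices $\Lambda$ with $0\preceq\Lambda\preceq\Sigma$, $|\cdot|$ is the determinant, the logarithm and the mutual information use the same base, and $\log\frac{a}{0}=+\infty$ for $a>0$. More generally, for every covariance matrix $\Sigma\succeq 0$, invertible or not, let $V$ be the column space of $\Sigma$; every diagonal $\Lambda$ with $0\preceq\Lambda\preceq\Sigma$ maps $V$ into $V$, and $$C(X^m)=\frac12\inf_{\Lambda}\log\frac{\big|\Sigma|_V\big|}{\big|\Lambda|_V\big|},$$ with the infimum over the same set of $\Lambda$ (both sides may be $+\infty$; the determinant on the zero space is $1$). -/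

import Mathlib

open MeasureTheory ProbabilityTheory
open scoped ENNReal

noncomputable section

/-- Mutual information `I(U; X)` (in nats) between `X ∼ Q` and the output `U` of the channel
`κ = P_{U|X}`: the relative entropy `D(P_{XU} ‖ P_X ⊗ P_U)`, a value in `[0, ∞]`. -/
def mutualInformation {α β : Type*} [MeasurableSpace α] [MeasurableSpace β]
    (Q : Measure α) (κ : Kernel α β) : ℝ≥0∞ :=
  InformationTheory.klDiv (Q.compProd κ) (Q.prod (Q.bind κ))

/-- The coordinates `X₁, …, X_m` of `X ∼ Q` are independent conditionally on the output `U` of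
`κ = P_{U|X}`: for `P_U`-almost every `u`, the coordinates are independent under the conditional
law `P_{X|U=u}`. The posterior kernel of `κ` is Mathlib's version of `P_{X|U}`. -/
def CondIndepCoords {m : ℕ} {β : Type*} [MeasurableSpace β]
    (Q : Measure (Fin m → ℝ)) [IsFiniteMeasure Q]
    (κ : Kernel (Fin m → ℝ) β) [IsFiniteKernel κ] : Prop :=
  ∀ᵐ u ∂(Q.bind κ), iIndepFun (fun (i : Fin m) (x : Fin m → ℝ) => x i) (posterior κ Q u)

/-- Wyner's common information `C(X₁, …, X_m) = inf_U I(U; X₁, …, X_m)` of the joint law `Q` of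
`(X₁, …, X_m)`: the infimum is over all alphabets of `U` and all channels `P_{U|X₁…X_m}` that make
`X₁, …, X_m` independent conditionally on `U`. -/
def commonInformation {m : ℕ} (Q : Measure (Fin m → ℝ)) [IsFiniteMeasure Q] : ℝ≥0∞ :=
  ⨅ (β : Type) (_ : MeasurableSpace β) (κ : Kernel (Fin m → ℝ) β) (_ : IsMarkovKernel κ)
    (_ : CondIndepCoords Q κ), mutualInformation Q κ

/-- The diagonal matrices `Λ` with `0 ⪯ Λ ⪯ S`. -/
def diagonalBelow {m : ℕ} (S : Matrix (Fin m) (Fin m) ℝ) : Set (Matrix (Fin m) (Fin m) ℝ) :=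
  {L | L.IsDiag ∧ L.PosSemidef ∧ (S - L).PosSemidef}

/-- The column space of `S`, as a subspace of Euclidean space. -/
def columnSpace {m : ℕ} (S : Matrix (Fin m) (Fin m) ℝ) : Submodule ℝ (EuclideanSpace ℝ (Fin m)) :=
  LinearMap.range (Matrix.toEuclideanLin S)

/-- The restriction `A|_V` of a matrix `A` to a subspace `V`, as an endomorphism of `V`: the
operator `v ↦ P_V (A v)` of the quadratic form of `A` restricted to `V`. If `A` maps `V` into
`V`, it is literally `v ↦ A v`; see `coe_restrictTo` and `toEuclideanLin_mem_columnSpace`. -/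
def restrictTo {m : ℕ} (V : Submodule ℝ (EuclideanSpace ℝ (Fin m)))
    (A : Matrix (Fin m) (Fin m) ℝ) : V →ₗ[ℝ] V :=
  V.orthogonalProjectionOnto.toLinearMap ∘ₗ Matrix.toEuclideanLin A ∘ₗ V.subtype

theorem coe_restrictTo {m : ℕ} (V : Submodule ℝ (EuclideanSpace ℝ (Fin m)))
    (A : Matrix (Fin m) (Fin m) ℝ) (v : V) (h : Matrix.toEuclideanLin A v ∈ V) :
    (restrictTo V A v : EuclideanSpace ℝ (Fin m)) = Matrix.toEuclideanLin A v := by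
  have := Submodule.orthogonalProjectionOnto_mem_subspace_eq_self (K := V)
    ⟨Matrix.toEuclideanLin A v, h⟩
  simpa [restrictTo] using congrArg Subtype.val this

/-- Every diagonal `Λ` with `0 ⪯ Λ ⪯ S` maps everything into the column space of `S`. -/
theorem toEuclideanLin_mem_columnSpace {m : ℕ} {S L : Matrix (Fin m) (Fin m) ℝ}
    (hL : L ∈ diagonalBelow S) (v : EuclideanSpace ℝ (Fin m)) :
    Matrix.toEuclideanLin L v ∈ columnSpace S := by
  obtain ⟨-, h1, h2⟩ := hL
  rw [← Submodule.orthogonal_orthogonal (columnSpace S), Submodule.mem_orthogonal]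
  intro w hw
  have hS : dotProduct w.ofLp (S.mulVec w.ofLp) = 0 := by
    have := (Submodule.mem_orthogonal _ _).1 hw (Matrix.toEuclideanLin S w) ⟨w, rfl⟩
    simpa [EuclideanSpace.inner_eq_star_dotProduct] using this
  have hd := h2.dotProduct_mulVec_nonneg w.ofLp
  have hl := h1.dotProduct_mulVec_nonneg w.ofLp
  rw [Matrix.sub_mulVec, dotProduct_sub] at hd
  simp only [star_trivial] at hd hl
  have h0 : L.mulVec w.ofLp = 0 :=
    (h1.dotProduct_mulVec_zero_iff w.ofLp).1 (by simp only [star_trivial]; linarith)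
  have ht : L.transpose = L := by simpa using h1.isHermitian.eq
  have : dotProduct (L.mulVec v.ofLp) w.ofLp = 0 := by
    rw [dotProduct_comm, Matrix.dotProduct_mulVec, ← Matrix.mulVec_transpose, ht, h0,
      zero_dotProduct]
  simpa [EuclideanSpace.inner_eq_star_dotProduct] using this

end

/-! Factor `S = T * Tᵀ` with `Aᵀ * T = 1`, where the number `d` of columns of `T` is the rank. Then
`W = Aᵀ (X - EX)` is standard Gaussian on `ℝ^d` and `X = EX + T W` almost surely. For a given
diagonal `L` with `0 ⪯ L ⪯ S`, the factorization can be chosen so that also `L = T * diagonal l *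
Tᵀ` with `0 ≤ l j ≤ 1` (`exists_whitening`), and the determinant ratio on the column space is `1 / ∏
l j`.

Lower bound: given `U`, the coordinates of `X` are independent, so the conditional covariance is
diagonal. Its average `L` over `U` is diagonal too, and `0 ⪯ L ⪯ S` (`exists_mem_diagonalBelow`). In
the coordinates adapted to `L`, the average conditional variance of `W_j` is `l j`. The
Donsker-Varadhan bound, tested on the log-density of `N(E[W|U], diag v)` relative to `N(0, 1)`,
gives `I(U; X) ≥ -½ ∑ log v j` whenever `v j > l j` (`ofReal_sum_le_klDiv_compProd`). Then `v`
decreases to `l`.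

Upper bound: if all `l j > 0`, take `U ∼ N(0, 1 - diag l)` and `W = U + N(0, diag l)` with
independent noise. Given `U`, the vector `X` is Gaussian with diagonal covariance `L`, hence has
independent coordinates, and data processing gives `I(U; X) ≤ I(U; W) = -½ ∑ log l j`
(`commonInformation_le`). If some `l j = 0`, the term is `+∞`. -/

open scoped NNReal

/-! ### Simultaneous diagonalization and whitening of matrices. -/

open Matrix in
theorem Matrix.IsHermitian.exists_orthogonal_diagonalization {n : Type*} [Fintype n] [DecidableEq n]
    {M : Matrix n n ℝ} (hM : M.IsHermitian) :
    ∃ (O : Matrix n n ℝ) (l : n → ℝ), O * Oᵀ = 1 ∧ Oᵀ * O = 1 ∧ M = O * diagonal l * Oᵀ := by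
  refine ⟨hM.eigenvectorUnitary, hM.eigenvalues, ?_, ?_, ?_⟩
  · have := Unitary.coe_mul_star_self hM.eigenvectorUnitary
    simpa [star_eq_conjTranspose] using this
  · have := Unitary.coe_star_mul_self hM.eigenvectorUnitary
    simpa [star_eq_conjTranspose] using this
  · have := hM.spectral_theorem
    rw [Unitary.conjStarAlgAut_apply] at this
    simpa [star_eq_conjTranspose, Function.comp_def] using this

open Matrix in
/-- A positive definite and a symmetric matrix are simultaneously diagonalized by a congruence. -/
theorem Matrix.PosDef.exists_simultaneous_diagonalization {n : Type*} [Fintype n] [DecidableEq n]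
    {S L : Matrix n n ℝ} (hS : S.PosDef) (hL : L.IsHermitian) :
    ∃ (D : Matrix n n ℝ) (l : n → ℝ), IsUnit D ∧ S = D * Dᵀ ∧ L = D * diagonal l * Dᵀ := by
  obtain ⟨O, s, hO, hO', hSO⟩ := hS.isHermitian.exists_orthogonal_diagonalization
  have hs : ∀ i, 0 < s i := by
    rw [← posDef_diagonal_iff]
    have h := hS.conjTranspose_mul_mul_same (B := O)
      (mulVec_injective_of_isUnit (IsUnit.of_mul_eq_one _ hO))
    rw [hSO] at h
    convert h using 1
    rw [conjTranspose_eq_transpose_of_trivial]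
    calc diagonal s = (Oᵀ * O) * diagonal s * (Oᵀ * O) := by simp [hO']
      _ = _ := by simp only [Matrix.mul_assoc]
  -- `K` satisfies `S = K Kᵀ` and `K'` is its inverse; an orthogonal `O₂` diagonalizing `K' L K'ᵀ`
  -- leaves `K Kᵀ` unchanged, so `D = K O₂` serves both matrices.
  set K : Matrix n n ℝ := O * diagonal (fun i => √(s i)) with hK
  set K' : Matrix n n ℝ := diagonal (fun i => (√(s i))⁻¹) * Oᵀ with hK'
  have hss : ∀ i, √(s i) * (√(s i))⁻¹ = 1 := fun i => mul_inv_cancel₀ (Real.sqrt_pos.2 (hs i)).ne'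
  have hKK' : K * K' = 1 := by
    calc K * K' = O * (diagonal (fun i => √(s i)) * diagonal (fun i => (√(s i))⁻¹)) * Oᵀ := by
          simp only [hK, hK', Matrix.mul_assoc]
      _ = 1 := by simp [diagonal_mul_diagonal, hss, hO]
  have hKS : S = K * Kᵀ := by
    calc S = O * (diagonal (fun i => √(s i)) * diagonal (fun i => √(s i))) * Oᵀ := by
          rw [diagonal_mul_diagonal, hSO]
          simp only [Real.mul_self_sqrt (hs _).le]
      _ = K * Kᵀ := by simp only [hK, transpose_mul, diagonal_transpose, Matrix.mul_assoc]
  have hM : (K' * L * K'ᵀ).IsHermitian := by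
    have := isHermitian_mul_mul_conjTranspose K' hL
    rwa [conjTranspose_eq_transpose_of_trivial] at this
  obtain ⟨O₂, l, hO₂, hO₂', hMO⟩ := hM.exists_orthogonal_diagonalization
  have hKt : K'ᵀ * Kᵀ = 1 := by rw [← transpose_mul, hKK', transpose_one]
  refine ⟨K * O₂, l, (IsUnit.of_mul_eq_one _ hKK').mul (IsUnit.of_mul_eq_one _ hO₂), ?_, ?_⟩
  · calc S = K * (O₂ * O₂ᵀ) * Kᵀ := by rw [hO₂, Matrix.mul_one, hKS]
      _ = _ := by rw [transpose_mul K O₂]; simp only [Matrix.mul_assoc]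
  · calc L = (K * K') * L * (K'ᵀ * Kᵀ) := by simp [hKK', hKt]
      _ = K * (K' * L * K'ᵀ) * Kᵀ := by simp only [Matrix.mul_assoc]
      _ = _ := by rw [hMO, transpose_mul K O₂]; simp only [Matrix.mul_assoc]

open Matrix in
theorem mulVec_mem_columnSpace {m : ℕ} (S : Matrix (Fin m) (Fin m) ℝ)
    (v : EuclideanSpace ℝ (Fin m)) : toEuclideanLin S v ∈ columnSpace S := ⟨v, rfl⟩

open Matrix in
/-- Coordinates in which a covariance matrix `S` becomes the identity and a diagonal matrix below
it becomes diagonal with entries in `[0, 1]`. -/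
theorem exists_whitening {m : ℕ} {S L : Matrix (Fin m) (Fin m) ℝ} (hS : S.PosSemidef)
    (hL : L ∈ diagonalBelow S) :
    ∃ (d : ℕ) (A T : Matrix (Fin m) (Fin d) ℝ) (l : Fin d → ℝ), Aᵀ * T = 1 ∧ S = T * Tᵀ ∧
      L = T * diagonal l * Tᵀ ∧ (∀ j, 0 ≤ l j) ∧ (∀ j, l j ≤ 1) ∧
      0 < LinearMap.det (restrictTo (columnSpace S) S) ∧
      LinearMap.det (restrictTo (columnSpace S) L) =
        LinearMap.det (restrictTo (columnSpace S) S) * ∏ j, l j := by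
  set V := columnSpace S
  set d := Module.finrank ℝ V
  let e : OrthonormalBasis (Fin d) ℝ V := stdOrthonormalBasis ℝ V
  -- The columns of `B` are an orthonormal basis of `V`: `B Bᵀ` is the orthogonal projection onto
  -- `V`, and `Bᵀ M B` is the matrix of `restrictTo V M`.
  let B : Matrix (Fin m) (Fin d) ℝ := Matrix.of fun i k => (e k : EuclideanSpace ℝ (Fin m)) i
  have hBB : Bᵀ * B = 1 := by
    ext k l
    have := orthonormal_iff_ite.1 e.orthonormal l k
    rw [Submodule.coe_inner, EuclideanSpace.inner_eq_star_dotProduct] at this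
    simp only [mul_apply, transpose_apply, B, of_apply, one_apply]
    simpa [dotProduct, eq_comm] using this
  have hproj : ∀ M : Matrix (Fin m) (Fin m) ℝ,
      (∀ v, toEuclideanLin M v ∈ V) → B * Bᵀ * M = M := by
    intro M hM
    ext i j
    set v : V := ⟨toEuclideanLin M (EuclideanSpace.single j 1), hM _⟩ with hv
    have h := congrArg (fun x : V => (x : EuclideanSpace ℝ (Fin m)) i) (e.sum_repr' v)
    have hvi : ∀ i, (v : EuclideanSpace ℝ (Fin m)) i = M i j := by
      intro i
      simp [hv, toLpLin_apply]
    simp only [Submodule.coe_sum, Submodule.coe_smul, WithLp.ofLp_sum, Finset.sum_apply,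
      WithLp.ofLp_smul, Pi.smul_apply, smul_eq_mul, hvi, Submodule.coe_inner,
      EuclideanSpace.inner_eq_star_dotProduct] at h
    rw [Matrix.mul_assoc, mul_apply, ← h]
    refine Finset.sum_congr rfl fun k _ => ?_
    rw [mul_comm]
    congr 1
    simp only [mul_apply, dotProduct, hvi, transpose_apply, B, of_apply]
    simp [mul_comm]
  have hdet : ∀ M : Matrix (Fin m) (Fin m) ℝ, LinearMap.det (restrictTo V M) = (Bᵀ * M * B).det := by
    intro M
    rw [← LinearMap.det_toMatrix e.toBasis]
    congr 1
    ext k l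
    rw [LinearMap.toMatrix_apply]
    simp only [OrthonormalBasis.coe_toBasis, OrthonormalBasis.coe_toBasis_repr_apply,
      OrthonormalBasis.repr_apply_apply, restrictTo, LinearMap.comp_apply]
    rw [ContinuousLinearMap.coe_coe, Submodule.inner_orthogonalProjectionOnto_eq_of_mem_left,
      EuclideanSpace.inner_eq_star_dotProduct, dotProduct_comm, Matrix.mul_assoc, mul_apply]
    simp [dotProduct, mul_apply, B, toLpLin_apply, mulVec]
  have hST : Sᵀ = S := by simpa using hS.isHermitian.eq
  have hLT : Lᵀ = L := by simpa using hL.2.1.isHermitian.eq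
  have hSP := hproj S (mulVec_mem_columnSpace S)
  have hLP := hproj L (toEuclideanLin_mem_columnSpace hL)
  have hPS : S * (B * Bᵀ) = S := by
    have := congrArg transpose hSP
    rwa [transpose_mul, transpose_mul, transpose_transpose, hST] at this
  have hPL : L * (B * Bᵀ) = L := by
    have := congrArg transpose hLP
    rwa [transpose_mul, transpose_mul, transpose_transpose, hLT] at this
  have hSB : S = B * (Bᵀ * S * B) * Bᵀ := by
    calc S = (B * Bᵀ * S) * (B * Bᵀ) := by rw [hSP, hPS]
      _ = _ := by simp only [Matrix.mul_assoc]
  have hLB : L = B * (Bᵀ * L * B) * Bᵀ := by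
    calc L = (B * Bᵀ * L) * (B * Bᵀ) := by rw [hLP, hPL]
      _ = _ := by simp only [Matrix.mul_assoc]
  have hS1 : (Bᵀ * S * B).PosDef := by
    have h1 : (Bᵀ * S * B).PosSemidef := by
      simpa using hS.conjTranspose_mul_mul_same B
    -- Each basis vector lies in the range of `S`, so `B = S Y`. Hence `S B x = 0` forces `x = Bᵀ B
    -- x = Yᵀ S B x = 0`, which gives definiteness on `V`.
    choose y hy using fun k => (e k).2
    have hBY : B = S * Matrix.of fun i k => y k i := by
      ext i k
      have := congrArg (fun v : EuclideanSpace ℝ (Fin m) => v i) (hy k)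
      simp only [B, of_apply, ← this, mul_apply]
      simp [toLpLin_apply, mulVec, dotProduct]
    refine .of_dotProduct_mulVec_pos h1.isHermitian fun x hx => ?_
    refine lt_of_le_of_ne (h1.dotProduct_mulVec_nonneg x) fun h0 => hx ?_
    have h2 : (S * B) *ᵥ x = 0 := by
      have h3 := (h1.dotProduct_mulVec_zero_iff x).1 h0.symm
      calc (S * B) *ᵥ x = B *ᵥ ((Bᵀ * S * B) *ᵥ x) := by
            rw [mulVec_mulVec]
            congr 1
            conv_lhs => rw [← hSP]
            simp only [Matrix.mul_assoc]
        _ = 0 := by rw [h3, mulVec_zero]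
    calc x = (Bᵀ * B) *ᵥ x := by rw [hBB, one_mulVec]
      _ = (Matrix.of fun i k => y k i)ᵀ *ᵥ ((S * B) *ᵥ x) := by
          rw [mulVec_mulVec, ← Matrix.mul_assoc]
          congr 2
          conv_lhs => rw [hBY, transpose_mul, hST]
      _ = 0 := by rw [h2, mulVec_zero]
  have hL1 : (Bᵀ * L * B).IsHermitian := by
    simpa using (hL.2.1.conjTranspose_mul_mul_same B).isHermitian
  obtain ⟨D, l, hD, hSD, hLD⟩ := hS1.exists_simultaneous_diagonalization hL1
  have hDi : D⁻¹ * D = 1 := nonsing_inv_mul _ ((isUnit_iff_isUnit_det D).1 hD)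
  have hAT : (B * D⁻¹ᵀ)ᵀ * (B * D) = 1 := by
    calc (B * D⁻¹ᵀ)ᵀ * (B * D) = D⁻¹ * (Bᵀ * B) * D := by
          simp only [transpose_mul, transpose_transpose, Matrix.mul_assoc]
      _ = 1 := by rw [hBB, Matrix.mul_one, hDi]
  have hTT : S = (B * D) * (B * D)ᵀ := by
    rw [hSB, hSD]; simp only [transpose_mul, Matrix.mul_assoc]
  have hTL : L = (B * D) * diagonal l * (B * D)ᵀ := by
    rw [hLB, hLD]; simp only [transpose_mul, Matrix.mul_assoc]
  -- Congruence by `A = B D⁻¹ᵀ` recovers the diagonal, so positivity of `L` and of `S - L` becomes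
  -- `0 ≤ l j` and `l j ≤ 1`.
  have key : ∀ g : Fin d → ℝ, (B * D⁻¹ᵀ)ᵀ * ((B * D) * diagonal g * (B * D)ᵀ) * (B * D⁻¹ᵀ) =
      diagonal g := by
    intro g
    have := congrArg transpose hAT
    rw [transpose_mul, transpose_transpose, transpose_one] at this
    calc _ = ((B * D⁻¹ᵀ)ᵀ * (B * D)) * diagonal g * ((B * D)ᵀ * (B * D⁻¹ᵀ)) := by
          simp only [Matrix.mul_assoc]
      _ = _ := by rw [hAT, this]; simp
  have hdS : 0 < (Bᵀ * S * B).det := hS1.det_pos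
  refine ⟨d, B * D⁻¹ᵀ, B * D, l, hAT, hTT, hTL, ?_, ?_, ?_, ?_⟩
  · rw [← posSemidef_diagonal_iff, ← key, ← hTL]
    exact hL.2.1.conjTranspose_mul_mul_same (B * D⁻¹ᵀ)
  · have h : ∀ j, 0 ≤ 1 - l j := by
      rw [← posSemidef_diagonal_iff, ← key]
      have h := hL.2.2.conjTranspose_mul_mul_same (B * D⁻¹ᵀ)
      have hd1 : diagonal (fun i => 1 - l i) = 1 - diagonal l := by
        rw [← diagonal_one, diagonal_sub]
      have h2 : B * D * diagonal (fun i => 1 - l i) * (B * D)ᵀ = S - L := by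
        rw [hd1, Matrix.mul_sub, Matrix.sub_mul, Matrix.mul_one, ← hTT, ← hTL]
      rw [h2]
      exact h
    exact fun j => sub_nonneg.1 (h j)
  · rw [hdet]; exact hdS
  · rw [hdet, hdet, hLD, hSD, det_mul, det_mul, det_mul, det_diagonal]
    ring

/-! ### Product measures and densities of product Gaussians. -/

theorem MeasureTheory.lintegral_pi_prod {ι : Type*} [Fintype ι] {E : ι → Type*}
    [∀ i, MeasurableSpace (E i)] (μ : ∀ i, Measure (E i)) [∀ i, IsProbabilityMeasure (μ i)]
    {f : ∀ i, E i → ℝ≥0∞} (hf : ∀ i, Measurable (f i)) :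
    ∫⁻ x, ∏ i, f i (x i) ∂Measure.pi μ = ∏ i, ∫⁻ x, f i x ∂μ i := by
  have h : iIndepFun (fun i (x : ∀ i, E i) => f i (x i)) (Measure.pi μ) :=
    iIndepFun_pi fun i => (hf i).aemeasurable
  rw [lintegral_prod_eq_prod_lintegral_of_indepFun Finset.univ _ h
    fun i => (hf i).comp (measurable_pi_apply i)]
  refine Finset.prod_congr rfl fun i _ => ?_
  exact (measurePreserving_eval μ i).lintegral_comp (hf i)

theorem MeasureTheory.Measure.pi_withDensity {ι : Type*} [Fintype ι] {E : ι → Type*}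
    [∀ i, MeasurableSpace (E i)] (μ : ∀ i, Measure (E i)) [∀ i, IsProbabilityMeasure (μ i)]
    {f : ∀ i, E i → ℝ≥0∞} (hf : ∀ i, Measurable (f i))
    [∀ i, SigmaFinite ((μ i).withDensity (f i))] :
    Measure.pi (fun i => (μ i).withDensity (f i)) =
      (Measure.pi μ).withDensity fun x => ∏ i, f i (x i) := by
  refine Measure.pi_eq fun s hs => ?_
  rw [withDensity_apply _ (MeasurableSet.univ_pi hs), ← lintegral_indicator (.univ_pi hs)]
  have h : ∀ x : ∀ i, E i, (Set.univ.pi s).indicator (fun x => ∏ i, f i (x i)) x =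
      ∏ i, (s i).indicator (f i) (x i) := by
    intro x
    by_cases hx : x ∈ Set.univ.pi s
    · rw [Set.indicator_of_mem hx]
      exact Finset.prod_congr rfl fun i _ => (Set.indicator_of_mem (hx i trivial) _).symm
    · rw [Set.indicator_of_notMem hx]
      obtain ⟨i, hi⟩ : ∃ i, x i ∉ s i := by simpa [Set.mem_univ_pi] using hx
      exact (Finset.prod_eq_zero (Finset.mem_univ i) (Set.indicator_of_notMem hi _)).symm
  simp_rw [h]
  rw [lintegral_pi_prod μ fun i => (hf i).indicator (hs i)]
  refine Finset.prod_congr rfl fun i _ => ?_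
  rw [withDensity_apply _ (hs i), lintegral_indicator (hs i)]

noncomputable section

/-- The logarithm of the density of `N(n, v)` with respect to `N(0, 1)`. -/
def gaussianLogRatio (v n x : ℝ) : ℝ := -(Real.log v) / 2 - (x - n) ^ 2 / (2 * v) + x ^ 2 / 2

/-- The logarithm of the density of the product of the `N(n j, v j)` with respect to the standard
Gaussian measure on `ℝ^d`. -/
def piGaussianLogRatio {d : ℕ} (v n x : Fin d → ℝ) : ℝ :=
  ∑ j, gaussianLogRatio (v j) (n j) (x j)

end

@[fun_prop]
theorem Measurable.gaussianLogRatio {α : Type*} [MeasurableSpace α] (v : ℝ) {n x : α → ℝ}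
    (hn : Measurable n) (hx : Measurable x) :
    Measurable fun a => gaussianLogRatio v (n a) (x a) := by
  unfold _root_.gaussianLogRatio
  fun_prop

@[fun_prop]
theorem Measurable.piGaussianLogRatio {α : Type*} [MeasurableSpace α] {d : ℕ} (v : Fin d → ℝ)
    {n x : α → Fin d → ℝ} (hn : Measurable n) (hx : Measurable x) :
    Measurable fun a => piGaussianLogRatio v (n a) (x a) := by
  unfold _root_.piGaussianLogRatio
  exact Finset.measurable_sum _ fun j _ => Measurable.gaussianLogRatio _ (by fun_prop) (by fun_prop)

theorem gaussianReal_eq_withDensity (n : ℝ) {v : ℝ≥0} (hv : v ≠ 0) :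
    gaussianReal n v = (gaussianReal 0 1).withDensity
      fun x => ENNReal.ofReal (Real.exp (gaussianLogRatio v n x)) := by
  rw [gaussianReal_of_var_ne_zero _ hv, gaussianReal_of_var_ne_zero _ one_ne_zero,
    ← withDensity_mul _ (by fun_prop) (by fun_prop)]
  congr 1
  ext x
  rw [Pi.mul_apply, gaussianPDF, gaussianPDF, ← ENNReal.ofReal_mul (gaussianPDFReal_nonneg _ _ _)]
  congr 1
  have hv' : (0 : ℝ) < v := by positivity
  have hsq : (√(v : ℝ))⁻¹ = Real.exp (-(Real.log v) / 2) := by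
    rw [neg_div, Real.exp_neg, Real.sqrt_eq_rpow, Real.rpow_def_of_pos hv']
    congr 3; ring
  simp only [gaussianPDFReal]
  rw [Real.sqrt_mul (by positivity), mul_inv, hsq, NNReal.coe_one, mul_one, mul_assoc, mul_assoc,
    ← Real.exp_add, ← Real.exp_add, gaussianLogRatio]
  congr 2
  ring

theorem pi_gaussianReal_eq_withDensity {d : ℕ} (n : Fin d → ℝ) {v : Fin d → ℝ≥0}
    (hv : ∀ j, v j ≠ 0) :
    Measure.pi (fun j => gaussianReal (n j) (v j)) =
      (Measure.pi fun _ : Fin d => gaussianReal 0 1).withDensity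
        fun x => ENNReal.ofReal (Real.exp (piGaussianLogRatio (fun j => v j) n x)) := by
  have h := fun j => gaussianReal_eq_withDensity (n j) (hv j)
  have : ∀ j, IsProbabilityMeasure ((gaussianReal 0 1).withDensity
      fun x => ENNReal.ofReal (Real.exp (gaussianLogRatio (v j) (n j) x))) := fun j => by
    rw [← h j]; infer_instance
  simp_rw [h]
  rw [Measure.pi_withDensity (f := fun j x =>
    ENNReal.ofReal (Real.exp (gaussianLogRatio (v j) (n j) x))) _ (fun j => by fun_prop)]
  congr 1
  ext x
  rw [piGaussianLogRatio, Real.exp_sum, ENNReal.ofReal_prod_of_nonneg fun _ _ => (Real.exp_pos _).le]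

theorem lintegral_exp_piGaussianLogRatio {d : ℕ} (n : Fin d → ℝ) {v : Fin d → ℝ≥0}
    (hv : ∀ j, v j ≠ 0) :
    ∫⁻ x, ENNReal.ofReal (Real.exp (piGaussianLogRatio (fun j => v j) n x))
      ∂(Measure.pi fun _ : Fin d => gaussianReal 0 1) = 1 := by
  rw [← setLIntegral_univ, ← withDensity_apply _ .univ, ← pi_gaussianReal_eq_withDensity n hv,
    measure_univ]

/-! ### Relative entropy and exponential densities. -/

open InformationTheory in
/-- The Donsker-Varadhan lower bound for a normalized exponential density. -/
theorem InformationTheory.ofReal_integral_le_klDiv {α : Type*} [MeasurableSpace α]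
    (μ ν : Measure α) [IsProbabilityMeasure μ] [IsProbabilityMeasure ν] {f : α → ℝ}
    (hf : Measurable f) (hfμ : Integrable f μ)
    (hfν : ∫⁻ x, ENNReal.ofReal (Real.exp (f x)) ∂ν = 1) :
    ENNReal.ofReal (∫ x, f x ∂μ) ≤ klDiv μ ν := by
  by_cases h : klDiv μ ν = ∞
  · simp [h]
  obtain ⟨hac, hint⟩ := klDiv_ne_top_iff.1 h
  have hexp : Integrable (fun x => Real.exp (f x)) ν := by
    refine ⟨by fun_prop, ?_⟩
    rw [hasFiniteIntegral_iff_ofReal (.of_forall fun _ => (Real.exp_pos _).le), hfν]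
    exact ENNReal.one_lt_top
  have hexp1 : ∫ x, Real.exp (f x) ∂ν = 1 := by
    rw [integral_eq_lintegral_of_nonneg_ae (.of_forall fun _ => (Real.exp_pos _).le) (by fun_prop),
      hfν, ENNReal.toReal_one]
  have := isProbabilityMeasure_tilted hexp
  -- Nonnegativity of the divergence of `μ` from `ν` tilted by `f`, which equals the divergence of
  -- `μ` from `ν` minus `∫ f dμ` because `∫ exp f dν = 1`.
  have h0 := integral_llr_add_sub_measure_univ_nonneg
    (hac.trans (absolutelyContinuous_tilted hexp))
    (integrable_llr_tilted_right hac hfμ hint hexp)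
  rw [integral_llr_tilted_right hac hfμ hexp hint, hexp1] at h0
  rw [klDiv_of_ac_of_integrable hac hint]
  refine ENNReal.ofReal_le_ofReal ?_
  simp at h0 ⊢
  linarith

-- The equality case of the previous bound: here `f` is itself the log-likelihood ratio.
open InformationTheory in
theorem InformationTheory.klDiv_withDensity_exp {α : Type*} [MeasurableSpace α]
    (ν : Measure α) [IsProbabilityMeasure ν] {f : α → ℝ} (hf : Measurable f)
    [IsProbabilityMeasure (ν.withDensity fun x => ENNReal.ofReal (Real.exp (f x)))]
    (hfμ : Integrable f (ν.withDensity fun x => ENNReal.ofReal (Real.exp (f x)))) :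
    klDiv (ν.withDensity fun x => ENNReal.ofReal (Real.exp (f x))) ν =
      ENNReal.ofReal (∫ x, f x ∂(ν.withDensity fun x => ENNReal.ofReal (Real.exp (f x)))) := by
  have hac := withDensity_absolutelyContinuous ν fun x => ENNReal.ofReal (Real.exp (f x))
  have hllr : llr (ν.withDensity fun x => ENNReal.ofReal (Real.exp (f x))) ν
      =ᵐ[ν.withDensity fun x => ENNReal.ofReal (Real.exp (f x))] f := by
    filter_upwards [hac.ae_le (Measure.rnDeriv_withDensity ν (hf.exp.ennreal_ofReal))] with x hx
    rw [llr, hx, ENNReal.toReal_ofReal (Real.exp_pos _).le, Real.log_exp]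
  rw [klDiv_of_ac_of_integrable hac ((integrable_congr hllr).2 hfμ), integral_congr_ae hllr]
  simp

/-! ### The additive Gaussian noise channel. -/

noncomputable section

/-- The channel `u ↦ N(u, diag v)` on `ℝ^d`. -/
def gaussianChannel {d : ℕ} (v : Fin d → ℝ≥0) : Kernel (Fin d → ℝ) (Fin d → ℝ) where
  toFun u := Measure.pi fun j => gaussianReal (u j) (v j)
  measurable' := by
    refine Measurable.measure_of_isPiSystem_of_isProbabilityMeasure generateFrom_pi.symm
      isPiSystem_pi ?_
    rintro _ ⟨s, hs, rfl⟩
    simp only [Measure.pi_pi]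
    refine Finset.measurable_prod _ fun j _ => ?_
    have h := measurable_gaussianReal.comp
      (((measurable_pi_apply j).prodMk measurable_const :
        Measurable fun u : Fin d → ℝ => (u j, v j)))
    exact (Measure.measurable_coe (show MeasurableSet (s j) from hs j trivial)).comp h

end

theorem gaussianChannel_apply {d : ℕ} (v : Fin d → ℝ≥0) (u : Fin d → ℝ) :
    gaussianChannel v u = Measure.pi fun j => gaussianReal (u j) (v j) := rfl

instance {d : ℕ} (v : Fin d → ℝ≥0) : IsMarkovKernel (gaussianChannel v) :=
  ⟨fun u => by rw [gaussianChannel_apply]; infer_instance⟩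

/-- `N(u, w)` is the translate by `u` of `N(0, w)`, so the mixture is a convolution and variances
add. -/
theorem lintegral_gaussianReal_apply (n : ℝ) (v w : ℝ≥0) {s : Set ℝ} (hs : MeasurableSet s) :
    ∫⁻ u, gaussianReal u w s ∂gaussianReal n v = gaussianReal n (v + w) s := by
  have h : gaussianReal n (v + w) = gaussianReal n v ∗ gaussianReal 0 w := by
    rw [gaussianReal_conv_gaussianReal, add_zero]
  rw [h, ← lintegral_indicator_one hs, Measure.lintegral_conv (measurable_one.indicator hs)]
  refine lintegral_congr fun u => ?_
  rw [← lintegral_indicator_one hs, ← zero_add u, ← gaussianReal_map_const_add,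
    lintegral_map (measurable_one.indicator hs) (by fun_prop), zero_add]

/-- The output of the Gaussian channel at a Gaussian input. -/
theorem bind_gaussianChannel {d : ℕ} (n : Fin d → ℝ) (v w : Fin d → ℝ≥0) :
    (Measure.pi fun j => gaussianReal (n j) (v j)).bind (gaussianChannel w) =
      Measure.pi fun j => gaussianReal (n j) (v j + w j) := by
  symm
  refine Measure.pi_eq fun s hs => ?_
  rw [Measure.bind_apply (.univ_pi hs) (Kernel.aemeasurable _)]
  simp only [gaussianChannel_apply, Measure.pi_pi]
  rw [lintegral_pi_prod (fun j => gaussianReal (n j) (v j)) (f := fun j u => gaussianReal u (w j) (s j))]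
  · exact Finset.prod_congr rfl fun j _ => lintegral_gaussianReal_apply _ _ _ (hs j)
  · intro j
    exact (Measure.measurable_coe (hs j)).comp (measurable_gaussianReal.comp
      ((measurable_id.prodMk measurable_const : Measurable fun u : ℝ => (u, w j))))

/-! ### Linear forms of a random vector and whitening of Gaussian laws. -/

open Matrix in
theorem covariance_dotProduct {ι : Type*} [Fintype ι] {Q : Measure (ι → ℝ)} [IsFiniteMeasure Q]
    (hQ : ∀ i, MemLp (fun x : ι → ℝ => x i) 2 Q) {S : Matrix ι ι ℝ}
    (hS : ∀ i j, S i j = cov[fun x => x i, fun x => x j; Q]) (a b : ι → ℝ) :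
    cov[fun x => a ⬝ᵥ x, fun x => b ⬝ᵥ x; Q] = a ⬝ᵥ S *ᵥ b := by
  simp only [dotProduct, mulVec]
  rw [covariance_fun_sum_fun_sum (fun i => (hQ i).const_mul _) (fun i => (hQ i).const_mul _)]
  refine Finset.sum_congr rfl fun i _ => ?_
  rw [Finset.mul_sum]
  refine Finset.sum_congr rfl fun j _ => ?_
  rw [covariance_const_mul_left, covariance_const_mul_right, hS]
  ring

open Matrix in
theorem memLp_dotProduct {ι : Type*} [Fintype ι] {Q : Measure (ι → ℝ)} {p : ℝ≥0∞}
    (hQ : ∀ i, MemLp (fun x : ι → ℝ => x i) p Q) (a : ι → ℝ) :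
    MemLp (fun x => a ⬝ᵥ x) p Q := by
  simp only [dotProduct]
  exact memLp_finsetSum _ fun i _ => (hQ i).const_mul _

open Matrix in
theorem integral_dotProduct {ι : Type*} [Fintype ι] {Q : Measure (ι → ℝ)}
    (hQ : ∀ i, Integrable (fun x : ι → ℝ => x i) Q) (a : ι → ℝ) :
    ∫ x, a ⬝ᵥ x ∂Q = a ⬝ᵥ fun i => ∫ x, x i ∂Q := by
  simp only [dotProduct]
  rw [integral_finsetSum _ fun i _ => (hQ i).const_mul _]
  simp only [integral_const_mul]

open Matrix in
theorem variance_dotProduct {ι : Type*} [Fintype ι] {Q : Measure (ι → ℝ)} [IsFiniteMeasure Q]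
    (hQ : ∀ i, MemLp (fun x : ι → ℝ => x i) 2 Q) {S : Matrix ι ι ℝ}
    (hS : ∀ i j, S i j = cov[fun x => x i, fun x => x j; Q]) (a : ι → ℝ) :
    Var[fun x => a ⬝ᵥ x; Q] = a ⬝ᵥ S *ᵥ a := by
  rw [← covariance_self (memLp_dotProduct hQ a).aemeasurable, covariance_dotProduct hQ hS]

open Matrix in
theorem posSemidef_of_covariance {ι : Type*} [Fintype ι] {Q : Measure (ι → ℝ)} [IsFiniteMeasure Q]
    (hQ : ∀ i, MemLp (fun x : ι → ℝ => x i) 2 Q) {S : Matrix ι ι ℝ}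
    (hS : ∀ i j, S i j = cov[fun x => x i, fun x => x j; Q]) : S.PosSemidef := by
  refine .of_dotProduct_mulVec_nonneg ?_ fun a => ?_
  · ext i j
    simp [hS, covariance_comm]
  · rw [star_trivial, ← variance_dotProduct hQ hS]
    exact variance_nonneg _ _

theorem ProbabilityTheory.IsGaussian.memLp_eval {ι : Type*} [Fintype ι] (Q : Measure (ι → ℝ))
    [IsGaussian Q] (i : ι) : MemLp (fun x : ι → ℝ => x i) 2 Q :=
  HasGaussianLaw.memLp_two
    ((IsGaussian.hasGaussianLaw_id (μ := Q)).map_fun (ContinuousLinearMap.proj i))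

/-- The mean vector of a law on `ℝ^ι`. -/
noncomputable def meanVec {ι : Type*} (Q : Measure (ι → ℝ)) (i : ι) : ℝ := ∫ x, x i ∂Q

open Matrix in
theorem measurable_whiten {ι κ : Type*} [Fintype ι] (A : Matrix ι κ ℝ) (c : ι → ℝ) :
    Measurable fun x : ι → ℝ => Aᵀ *ᵥ (x - c) := by
  unfold mulVec dotProduct
  fun_prop

open Matrix in
theorem measurable_unwhiten {ι κ : Type*} [Fintype κ] (T : Matrix ι κ ℝ) (c : ι → ℝ) :
    Measurable fun x : κ → ℝ => c + T *ᵥ x := by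
  unfold mulVec dotProduct
  fun_prop

open Matrix in
/-- An affine image of a Gaussian vector with identity covariance is standard Gaussian. -/
theorem map_whiten {ι κ : Type*} [Fintype ι] [Fintype κ] [DecidableEq κ] (Q : Measure (ι → ℝ))
    [IsGaussian Q] {S : Matrix ι ι ℝ} (hS : ∀ i j, S i j = cov[fun x => x i, fun x => x j; Q])
    {A : Matrix ι κ ℝ} (hA : Aᵀ * S * A = 1) :
    Q.map (fun x => Aᵀ *ᵥ (x - meanVec Q)) = Measure.pi fun _ : κ => gaussianReal 0 1 := by
  have hL := IsGaussian.memLp_eval Q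
  have hmeas := measurable_whiten A (meanVec Q)
  have hG : HasGaussianLaw (fun x : ι → ℝ => Aᵀ *ᵥ (x - meanVec Q)) Q := by
    have h1 := (IsGaussian.hasGaussianLaw_id (μ := Q)).map_fun (LinearMap.toContinuousLinearMap Aᵀ.mulVecLin)
    have : IsGaussian (Q.map fun x => LinearMap.toContinuousLinearMap Aᵀ.mulVecLin (id x)) :=
      h1.isGaussian_map
    refine ⟨?_⟩
    have h2 : (fun x : ι → ℝ => Aᵀ *ᵥ (x - meanVec Q)) =
        (fun y => y - Aᵀ *ᵥ meanVec Q) ∘ fun x =>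
          LinearMap.toContinuousLinearMap Aᵀ.mulVecLin (id x) := by
      ext1 x
      simp [mulVec_sub, mulVec_transpose]
    rw [h2, ← Measure.map_map (by fun_prop) (by fun_prop)]
    infer_instance
  have hrw : ∀ (j : κ) (x : ι → ℝ), (Aᵀ *ᵥ (x - meanVec Q)) j =
      A.col j ⬝ᵥ x - A.col j ⬝ᵥ meanVec Q := fun j x => by
    rw [← dotProduct_sub]; rfl
  have hint : ∀ j, Integrable (fun x => A.col j ⬝ᵥ x) Q := fun j =>
    (memLp_dotProduct hL _).integrable one_le_two
  have hcov : ∀ j k, cov[fun x => (Aᵀ *ᵥ (x - meanVec Q)) j, fun x => (Aᵀ *ᵥ (x - meanVec Q)) k; Q]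
      = (1 : Matrix κ κ ℝ) j k := by
    intro j k
    simp_rw [hrw]
    rw [covariance_sub_const_left (hint j), covariance_sub_const_right (hint k),
      covariance_dotProduct hL hS, ← hA, Matrix.mul_assoc]
    rfl
  have hind : iIndepFun (fun j (x : ι → ℝ) => (Aᵀ *ᵥ (x - meanVec Q)) j) Q :=
    hG.iIndepFun_of_covariance_eq_zero fun j k hjk => by rw [hcov, one_apply_ne hjk]
  have hmj : ∀ j, AEMeasurable (fun x => (Aᵀ *ᵥ (x - meanVec Q)) j) Q := fun j =>
    ((measurable_pi_apply j).comp hmeas).aemeasurable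
  rw [hind.map_fun_eq_pi_map hmj]
  congr 1
  ext1 j
  rw [(hG.eval j).map_eq_gaussianReal, ← covariance_self (hmj j), hcov, one_apply_eq]
  simp_rw [hrw]
  rw [integral_sub (hint j) (integrable_const _),
    integral_dotProduct fun i => (hL i).integrable one_le_two]
  simp [show (fun i => ∫ x : ι → ℝ, x i ∂Q) = meanVec Q from rfl]

-- The matrix `1 - T Aᵀ` need not vanish when `S` is singular, but `S (1 - T Aᵀ)ᵀ = 0`. Its rows are
-- thus linear forms of variance zero, almost surely equal to their means.
open Matrix in
theorem ae_unwhiten_whiten {ι κ : Type*} [Fintype ι] [DecidableEq ι] [Fintype κ] [DecidableEq κ]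
    (Q : Measure (ι → ℝ)) [IsGaussian Q] {S : Matrix ι ι ℝ}
    (hS : ∀ i j, S i j = cov[fun x => x i, fun x => x j; Q])
    {A T : Matrix ι κ ℝ} (hA : Aᵀ * T = 1) (hST : S = T * Tᵀ) :
    ∀ᵐ x ∂Q, meanVec Q + T *ᵥ (Aᵀ *ᵥ (x - meanVec Q)) = x := by
  have hL := IsGaussian.memLp_eval Q
  have hA' : Tᵀ * A = 1 := by
    rw [← transpose_one, ← hA, transpose_mul, transpose_transpose]
  have h : ∀ i, ∀ᵐ x ∂Q, (1 - T * Aᵀ : Matrix ι ι ℝ) i ⬝ᵥ x = (1 - T * Aᵀ : Matrix ι ι ℝ) i ⬝ᵥ meanVec Q := by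
    intro i
    have h1 := ae_eq_integral_of_variance_eq_zero (μ := Q)
      (memLp_dotProduct hL ((1 - T * Aᵀ : Matrix ι ι ℝ) i)) ?_
    · filter_upwards [h1] with x hx
      rw [hx, integral_dotProduct fun i => (hL i).integrable one_le_two]
      rfl
    · rw [variance_dotProduct hL hS]
      have h2 : S * (1 - T * Aᵀ)ᵀ = 0 := by
        rw [hST, transpose_sub, transpose_mul, transpose_transpose, transpose_one, Matrix.mul_sub,
          Matrix.mul_one, Matrix.mul_assoc, ← Matrix.mul_assoc Tᵀ A, hA', Matrix.one_mul, sub_self]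
      have h3 : S *ᵥ (1 - T * Aᵀ : Matrix ι ι ℝ) i = 0 := by
        ext k
        exact congrFun (congrFun h2 k) i
      rw [h3, dotProduct_zero]
  filter_upwards [ae_all_iff.2 h] with x hx
  have h4 : (1 - T * Aᵀ) *ᵥ (x - meanVec Q) = 0 := by
    ext i
    have := hx i
    simp only [mulVec, dotProduct_sub]
    simp only [Pi.zero_apply]
    linarith
  rw [sub_mulVec, one_mulVec, ← mulVec_mulVec, sub_eq_zero] at h4
  rw [mulVec_mulVec] at h4 ⊢
  rw [← h4]
  abel

open Matrix in
theorem map_unwhiten {ι κ : Type*} [Fintype ι] [DecidableEq ι] [Fintype κ] [DecidableEq κ]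
    (Q : Measure (ι → ℝ)) [IsGaussian Q] {S : Matrix ι ι ℝ}
    (hS : ∀ i j, S i j = cov[fun x => x i, fun x => x j; Q])
    {A T : Matrix ι κ ℝ} (hA : Aᵀ * T = 1) (hST : S = T * Tᵀ) :
    (Measure.pi fun _ : κ => gaussianReal 0 1).map (fun w => meanVec Q + T *ᵥ w) = Q := by
  have hASA : Aᵀ * S * A = 1 := by
    have hA' : Tᵀ * A = 1 := by
      rw [← transpose_one, ← hA, transpose_mul, transpose_transpose]
    rw [hST, ← Matrix.mul_assoc, hA, Matrix.one_mul, hA']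
  rw [← map_whiten Q hS hASA, Measure.map_map (measurable_unwhiten _ _) (measurable_whiten _ _)]
  conv_rhs => rw [← Measure.map_id (μ := Q)]
  refine Measure.map_congr ?_
  filter_upwards [ae_unwhiten_whiten Q hS hA hST] with x hx
  exact hx

/-! ### Conditional variances under a reverse channel `π = P_{X|U}`, with `ν = P_U` and `Q = P_X`.
-/

section ConditionalVariance

variable {β E : Type*} [MeasurableSpace β] [MeasurableSpace E] {ν : Measure β} {π : Kernel β E}

theorem ProbabilityTheory.Kernel.measurable_integral [IsMarkovKernel π] {f : E → ℝ}
    (hf : Measurable f) : Measurable fun u => ∫ x, f x ∂π u :=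
  hf.stronglyMeasurable.integral_kernel.measurable

theorem MeasureTheory.integrable_comp_snd_compProd [SFinite ν] [IsMarkovKernel π] {Q : Measure E}
    (hQ : ν.bind π = Q) {f : E → ℝ} (hf : Integrable f Q) :
    Integrable (fun p : β × E => f p.2) (ν.compProd π) := by
  rw [← hQ, ← Measure.snd_compProd] at hf
  exact hf.comp_measurable measurable_snd

theorem MeasureTheory.integral_comp_snd_compProd [SFinite ν] [IsMarkovKernel π] {Q : Measure E}
    (hQ : ν.bind π = Q) {f : E → ℝ} (hf : Measurable f) :
    ∫ p, f p.2 ∂(ν.compProd π) = ∫ x, f x ∂Q := by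
  rw [← hQ, ← Measure.snd_compProd, Measure.snd, integral_map (by fun_prop) (by fun_prop)]

variable [IsFiniteMeasure ν] [IsMarkovKernel π] {Q : Measure E}

theorem ae_memLp_two_kernel (hQ : ν.bind π = Q) {f : E → ℝ} (hf : Measurable f)
    (hfQ : MemLp f 2 Q) : ∀ᵐ u ∂ν, MemLp f 2 (π u) := by
  have h := integrable_comp_snd_compProd hQ hfQ.integrable_sq
  filter_upwards [h.ae_of_compProd] with u hu
  exact (memLp_two_iff_integrable_sq hf.aestronglyMeasurable).2 hu

theorem measurable_sq_sub_kernel_mean {f : E → ℝ} (hf : Measurable f) :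
    Measurable fun p : β × E => (f p.2 - ∫ y, f y ∂π p.1) ^ 2 :=
  ((hf.comp measurable_snd).sub
    ((Kernel.measurable_integral (π := π) hf).comp measurable_fst)).pow_const 2

theorem measurable_kernel_variance {f : E → ℝ} (hf : Measurable f) :
    Measurable fun u => Var[f; π u] := by
  have h : Measurable fun u => ∫ x, (f x - ∫ y, f y ∂π u) ^ 2 ∂π u := by
    exact (StronglyMeasurable.integral_kernel_prod_right'
      (measurable_sq_sub_kernel_mean hf).stronglyMeasurable).measurable
  simpa only [variance_eq_integral hf.aemeasurable] using h

theorem integrable_kernel_variance (hQ : ν.bind π = Q) {f : E → ℝ} (hf : Measurable f)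
    (hfQ : MemLp f 2 Q) : Integrable (fun u => Var[f; π u]) ν := by
  have h := (integrable_comp_snd_compProd hQ hfQ.integrable_sq).integral_compProd
  refine h.mono' (measurable_kernel_variance hf).aestronglyMeasurable (.of_forall fun u => ?_)
  rw [Real.norm_of_nonneg (variance_nonneg _ _)]
  exact variance_le_expectation_sq hf.aestronglyMeasurable

/-- Half of the law of total variance; applied to centred linear forms it yields `L ⪯ S`. -/
theorem integral_kernel_variance_le (hQ : ν.bind π = Q) {f : E → ℝ} (hf : Measurable f)
    (hfQ : MemLp f 2 Q) : ∫ u, Var[f; π u] ∂ν ≤ ∫ x, f x ^ 2 ∂Q := by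
  have hi := integrable_comp_snd_compProd hQ hfQ.integrable_sq
  rw [← integral_comp_snd_compProd hQ (hf.pow_const 2), Measure.integral_compProd hi]
  exact integral_mono (integrable_kernel_variance hQ hf hfQ) hi.integral_compProd
    fun u => variance_le_expectation_sq hf.aestronglyMeasurable

theorem integrable_sq_sub_kernel_mean (hQ : ν.bind π = Q) {f : E → ℝ} (hf : Measurable f)
    (hfQ : MemLp f 2 Q) :
    Integrable (fun p : β × E => (f p.2 - ∫ y, f y ∂π p.1) ^ 2) (ν.compProd π) := by
  rw [Measure.integrable_compProd_iff (measurable_sq_sub_kernel_mean hf).aestronglyMeasurable]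
  constructor
  · filter_upwards [ae_memLp_two_kernel hQ hf hfQ] with u hu
    exact (hu.sub (memLp_const _)).integrable_sq
  · refine (integrable_kernel_variance hQ hf hfQ).congr (.of_forall fun u => ?_)
    simp [variance_eq_integral hf.aemeasurable]

theorem integral_sq_sub_kernel_mean (hQ : ν.bind π = Q) {f : E → ℝ} (hf : Measurable f)
    (hfQ : MemLp f 2 Q) :
    ∫ p, (f p.2 - ∫ y, f y ∂π p.1) ^ 2 ∂(ν.compProd π) = ∫ u, Var[f; π u] ∂ν := by
  rw [Measure.integral_compProd (integrable_sq_sub_kernel_mean hQ hf hfQ)]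
  simp only [variance_eq_integral hf.aemeasurable]

theorem integrable_piGaussianLogRatio (hQ : ν.bind π = Q) {d : ℕ} (v : Fin d → ℝ)
    {w : E → Fin d → ℝ} (hw : Measurable w) (hwQ : ∀ j, MemLp (fun x => w x j) 2 Q) :
    Integrable (fun p : β × E => piGaussianLogRatio v (fun j => ∫ y, w y j ∂π p.1) (w p.2))
      (ν.compProd π) := by
  unfold piGaussianLogRatio gaussianLogRatio
  refine integrable_finsetSum _ fun j _ => ?_
  refine ((integrable_const _).sub ?_).add ?_
  · exact (integrable_sq_sub_kernel_mean hQ (by fun_prop : Measurable fun x => w x j)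
      (hwQ j)).div_const _
  · exact (integrable_comp_snd_compProd hQ (hwQ j).integrable_sq).div_const _

/-- Centring the Gaussian at the conditional mean turns the quadratic term into the average
conditional variance, so nothing else about `π` enters. -/
theorem integral_piGaussianLogRatio [IsProbabilityMeasure ν] (hQ : ν.bind π = Q) {d : ℕ}
    (v : Fin d → ℝ) {w : E → Fin d → ℝ} (hw : Measurable w)
    (hwQ : ∀ j, MemLp (fun x => w x j) 2 Q) :
    ∫ p, piGaussianLogRatio v (fun j => ∫ y, w y j ∂π p.1) (w p.2) ∂(ν.compProd π) =
      ∑ j, (-(Real.log (v j)) / 2 - (∫ u, Var[fun x => w x j; π u] ∂ν) / (2 * v j) +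
        (∫ x, w x j ^ 2 ∂Q) / 2) := by
  have hwj : ∀ j, Measurable fun x => w x j := fun j => by fun_prop
  have h1 := fun j => (integrable_sq_sub_kernel_mean hQ (hwj j) (hwQ j)).div_const (2 * v j)
  have h2 := fun j => (integrable_comp_snd_compProd hQ (hwQ j).integrable_sq).div_const 2
  have h3 : ∀ j, Integrable (fun p : β × E => -(Real.log (v j)) / 2 -
      (w p.2 j - ∫ y, w y j ∂π p.1) ^ 2 / (2 * v j)) (ν.compProd π) :=
    fun j => (integrable_const _).sub (h1 j)
  simp only [piGaussianLogRatio, gaussianLogRatio]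
  rw [integral_finsetSum]
  swap
  · exact fun j _ => (h3 j).add (h2 j)
  refine Finset.sum_congr rfl fun j _ => ?_
  rw [integral_add (h3 j) (h2 j),
    integral_sub (integrable_const _) (h1 j), integral_const, integral_div, integral_div,
    integral_sq_sub_kernel_mean hQ (hwj j) (hwQ j),
    integral_comp_snd_compProd hQ ((hwj j).pow_const 2)]
  simp

end ConditionalVariance

/-! ### The lower bound on mutual information. -/

open Matrix in
/-- The averaged conditional covariance matrix of conditionally independent coordinates is diagonal
and dominated by the covariance matrix. -/
theorem exists_mem_diagonalBelow {m : ℕ} {β : Type*} [MeasurableSpace β] {ν : Measure β}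
    [IsProbabilityMeasure ν] {π : Kernel β (Fin m → ℝ)} [IsMarkovKernel π]
    {Q : Measure (Fin m → ℝ)} [IsProbabilityMeasure Q] (hQ : ν.bind π = Q)
    (hL : ∀ i, MemLp (fun x : Fin m → ℝ => x i) 2 Q) {S : Matrix (Fin m) (Fin m) ℝ}
    (hS : ∀ i j, S i j = cov[fun x => x i, fun x => x j; Q])
    (hind : ∀ᵐ u ∂ν, iIndepFun (fun (i : Fin m) (x : Fin m → ℝ) => x i) (π u)) :
    ∃ L ∈ diagonalBelow S, ∀ a, ∫ u, Var[fun x => a ⬝ᵥ x; π u] ∂ν = a ⬝ᵥ L *ᵥ a := by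
  have hmeas : ∀ a : Fin m → ℝ, Measurable fun x : Fin m → ℝ => a ⬝ᵥ x := fun a => by
    unfold dotProduct; fun_prop
  set l : Fin m → ℝ := fun i => ∫ u, Var[fun x => x i; π u] ∂ν with hl
  have hl0 : ∀ i, 0 ≤ l i := fun i => integral_nonneg fun u => variance_nonneg _ _
  have key : ∀ a, ∫ u, Var[fun x => a ⬝ᵥ x; π u] ∂ν = a ⬝ᵥ diagonal l *ᵥ a := by
    intro a
    have h : ∀ᵐ u ∂ν, Var[fun x => a ⬝ᵥ x; π u] = ∑ i, a i ^ 2 * Var[fun x => x i; π u] := by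
      filter_upwards [hind, ae_all_iff.2 fun i =>
        ae_memLp_two_kernel hQ (measurable_pi_apply i) (hL i)] with u hu hLu
      have h1 : (fun x : Fin m → ℝ => a ⬝ᵥ x) = ∑ i, fun x : Fin m → ℝ => a i * x i := by
        ext x; simp [dotProduct]
      -- Conditional independence removes the cross terms; this is where the averaged covariance
      -- becomes diagonal.
      rw [h1, IndepFun.variance_sum (fun i _ => (hLu i).const_mul _)]
      · simp only [variance_const_mul]
      · intro i _ j _ hij
        exact (hu.indepFun hij).comp (measurable_const_mul (a i)) (measurable_const_mul (a j))
    rw [integral_congr_ae h, integral_finsetSum _ fun i _ =>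
      (integrable_kernel_variance hQ (measurable_pi_apply i) (hL i)).const_mul _]
    simp only [integral_const_mul, mulVec_diagonal, dotProduct]
    exact Finset.sum_congr rfl fun i _ => by rw [hl]; ring
  refine ⟨diagonal l, ⟨isDiag_diagonal l, posSemidef_diagonal_iff.2 hl0, ?_⟩, key⟩
  refine .of_dotProduct_mulVec_nonneg ?_ fun a => ?_
  · exact (posSemidef_of_covariance hL hS).isHermitian.sub (isHermitian_diagonal l)
  rw [star_trivial, sub_mulVec, dotProduct_sub, sub_nonneg, ← key, ← variance_dotProduct hL hS,
    variance_eq_integral (hmeas a).aemeasurable]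
  set c := ∫ x, a ⬝ᵥ x ∂Q
  -- Subtracting the global mean `c` leaves each conditional variance unchanged and makes the second
  -- moment under `Q` a variance.
  have := integral_kernel_variance_le hQ ((hmeas a).sub_const c)
    ((memLp_dotProduct hL a).sub (memLp_const c))
  refine le_trans (le_of_eq ?_) this
  refine integral_congr_ae (.of_forall fun u => ?_)
  exact (variance_sub_const (hmeas a).aestronglyMeasurable c).symm

open InformationTheory in
/-- Mutual information is computed from the reverse channel. -/
theorem klDiv_posterior_le_mutualInformation {E β : Type*} [MeasurableSpace E]
    [MeasurableSpace β] [StandardBorelSpace E] [Nonempty E] (Q : Measure E)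
    [IsProbabilityMeasure Q] (κ : Kernel E β) [IsMarkovKernel κ] :
    klDiv ((Q.bind κ).compProd (posterior κ Q)) ((Q.bind κ).prod Q) ≤ mutualInformation Q κ := by
  rw [compProd_posterior_eq_map_swap, ← Measure.prod_swap]
  exact klDiv_map_le _ _ measurable_swap

theorem memLp_of_map_eq {E : Type*} [MeasurableSpace E] {d : ℕ} {Q : Measure E}
    {w : E → Fin d → ℝ} (hw : Measurable w)
    (hwQ : Q.map w = Measure.pi fun _ => gaussianReal 0 1) (j : Fin d) :
    MemLp (fun x => w x j) 2 Q := by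
  have h : Q.map (fun x => w x j) = gaussianReal 0 1 := by
    have := (measurePreserving_eval (fun _ : Fin d => gaussianReal 0 1) j).map_eq
    rwa [← hwQ, Measure.map_map (measurable_pi_apply j) hw] at this
  have h2 := memLp_id_gaussianReal (μ := 0) (v := 1) 2
  rw [← h] at h2
  exact (memLp_map_measure_iff (by fun_prop) (by fun_prop)).1 h2

theorem integral_sq_of_map_eq {E : Type*} [MeasurableSpace E] {d : ℕ} {Q : Measure E}
    {w : E → Fin d → ℝ} (hw : Measurable w)
    (hwQ : Q.map w = Measure.pi fun _ => gaussianReal 0 1) (j : Fin d) :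
    ∫ x, w x j ^ 2 ∂Q = 1 := by
  have h : Q.map (fun x => w x j) = gaussianReal 0 1 := by
    have := (measurePreserving_eval (fun _ : Fin d => gaussianReal 0 1) j).map_eq
    rwa [← hwQ, Measure.map_map (measurable_pi_apply j) hw] at this
  have h1 : ∫ x, x ^ 2 ∂gaussianReal 0 1 = 1 := by
    have h := variance_fun_id_gaussianReal (μ := 0) (v := 1)
    rw [variance_of_integral_eq_zero (by fun_prop) (by simp)] at h
    simpa using h
  rw [← h1, ← h, integral_map (by fun_prop) (by fun_prop)]

-- For each fixed `u` the test density integrates to 1 against `Q`, as `w` is standard Gaussian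
-- under `Q`. Its expected logarithm is a sum of `-½ log v j + ½ - (average conditional variance) /
-- (2 v j)`, and `hl` makes the last two terms together nonnegative.
open InformationTheory in
theorem ofReal_sum_le_klDiv_compProd {β E : Type*} [MeasurableSpace β] [MeasurableSpace E]
    {ν : Measure β} [IsProbabilityMeasure ν] {π : Kernel β E} [IsMarkovKernel π] {Q : Measure E}
    [IsProbabilityMeasure Q] (hQ : ν.bind π = Q) {d : ℕ} {w : E → Fin d → ℝ} (hw : Measurable w)
    (hwQ : Q.map w = Measure.pi fun _ => gaussianReal 0 1) {v : Fin d → ℝ≥0} (hv : ∀ j, v j ≠ 0)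
    (hl : ∀ j, ∫ u, Var[fun x => w x j; π u] ∂ν ≤ v j) :
    ENNReal.ofReal (∑ j, -(Real.log (v j)) / 2) ≤ klDiv (ν.compProd π) (ν.prod Q) := by
  have hL := memLp_of_map_eq hw hwQ
  have hn : Measurable fun (u : β) (j : Fin d) => ∫ y, w y j ∂π u :=
    measurable_pi_lambda _ fun j => Kernel.measurable_integral (by fun_prop)
  have hF : Measurable fun p : β × E =>
      piGaussianLogRatio (fun j => (v j : ℝ)) (fun j => ∫ y, w y j ∂π p.1) (w p.2) :=
    Measurable.piGaussianLogRatio _ (hn.comp measurable_fst) (hw.comp measurable_snd)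
  refine le_trans (ENNReal.ofReal_le_ofReal ?_) (ofReal_integral_le_klDiv _ _ hF
    (integrable_piGaussianLogRatio hQ (fun j => (v j : ℝ)) hw hL) ?_)
  · rw [integral_piGaussianLogRatio hQ _ hw hL]
    refine Finset.sum_le_sum fun j _ => ?_
    have hvj : (0 : ℝ) < v j := by have := hv j; positivity
    rw [integral_sq_of_map_eq hw hwQ]
    have : (∫ u, Var[fun x => w x j; π u] ∂ν) / (2 * v j) ≤ 1 / 2 := by
      rw [div_le_div_iff₀ (by positivity) two_pos]
      linarith [hl j]
    linarith
  · rw [lintegral_prod _ hF.exp.ennreal_ofReal.aemeasurable]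
    have h1 : ∀ u : β, ∫⁻ x, ENNReal.ofReal (Real.exp (piGaussianLogRatio (fun j => (v j : ℝ))
        (fun j => ∫ y, w y j ∂π u) (w x))) ∂Q = 1 := fun u => by
      rw [← lintegral_exp_piGaussianLogRatio (fun j => ∫ y, w y j ∂π u) hv, ← hwQ,
        lintegral_map (by fun_prop) hw]
    simp [h1]

theorem half_log_inv_prod {d : ℕ} {v : Fin d → ℝ} (hv : ∀ j, 0 < v j) :
    ((1 / 2 : ℝ) : EReal) * ENNReal.log (∏ j, ENNReal.ofReal (v j))⁻¹ =
      ((∑ j, -(Real.log (v j)) / 2 : ℝ) : EReal) := by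
  have hp : 0 < ∏ j, v j := Finset.prod_pos fun j _ => hv j
  rw [← ENNReal.ofReal_prod_of_nonneg fun j _ => (hv j).le, ← ENNReal.ofReal_inv_of_pos hp,
    ENNReal.log_ofReal_of_pos (inv_pos.2 hp), ← EReal.coe_mul, Real.log_inv,
    Real.log_prod fun j _ => (hv j).ne']
  congr 1
  rw [← Finset.sum_div, Finset.sum_neg_distrib]
  ring

open Filter Topology in
/-- The value `½ log (1 / ∏ l)` is approached from strictly positive variances. -/
theorem half_log_inv_prod_le {d : ℕ} {l : Fin d → ℝ} (hl : ∀ j, 0 ≤ l j) {C : ℝ≥0∞}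
    (h : ∀ v : Fin d → ℝ≥0, (∀ j, l j < v j) →
      ENNReal.ofReal (∑ j, -(Real.log (v j)) / 2) ≤ C) :
    ((1 / 2 : ℝ) : EReal) * ENNReal.log (∏ j, ENNReal.ofReal (l j))⁻¹ ≤ C := by
  have ht : Tendsto (fun ε : ℝ => ((1 / 2 : ℝ) : EReal) *
      ENNReal.log (∏ j, ENNReal.ofReal (l j + ε))⁻¹) (𝓝[>] 0)
      (𝓝 (((1 / 2 : ℝ) : EReal) * ENNReal.log (∏ j, ENNReal.ofReal (l j))⁻¹)) := by
    refine EReal.Tendsto.const_mul ?_ (Or.inl (EReal.coe_ne_bot _)) (Or.inl (EReal.coe_ne_top _))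
    -- Logarithm and inverse are continuous on all of `[0, ∞]`, so a vanishing `l j` needs no
    -- separate case.
    refine (ENNReal.continuous_log.tendsto _).comp ?_
    refine (continuous_inv.tendsto (∏ j, ENNReal.ofReal (l j))).comp ?_
    refine ENNReal.tendsto_finsetProd_of_ne_top _ (fun j _ => ?_) (fun j _ => ENNReal.ofReal_ne_top)
    refine (ENNReal.continuous_ofReal.tendsto _).comp ?_
    have : Tendsto (fun ε : ℝ => l j + ε) (𝓝 0) (𝓝 (l j + 0)) := by
      exact (continuous_const.add continuous_id).tendsto 0
    rw [add_zero] at this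
    exact this.mono_left nhdsWithin_le_nhds
  refine le_of_tendsto ht ?_
  filter_upwards [self_mem_nhdsWithin] with ε hε
  have hε' : 0 < ε := hε
  have hpos : ∀ j, 0 < l j + ε := fun j => add_pos_of_nonneg_of_pos (hl j) hε'
  have h1 := h (fun j => ⟨l j + ε, (hpos j).le⟩) fun j => by
    show l j < l j + ε
    linarith
  rw [half_log_inv_prod hpos]
  refine le_trans ?_ (EReal.coe_ennreal_le_coe_ennreal_iff.2 h1)
  rw [EReal.coe_ennreal_ofReal]
  exact EReal.coe_le_coe_iff.2 (le_max_left _ _)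

/-! ### The upper bound by an additive Gaussian decomposition. -/

/-- Subtraction in `ℝ≥0` is truncated; `v j ≤ 1` makes the variances `1 - v j` and `v j` add up to
1. -/
theorem bind_gaussianChannel_standard {d : ℕ} {v : Fin d → ℝ≥0} (hv : ∀ j, v j ≤ 1) :
    (Measure.pi fun j => gaussianReal 0 (1 - v j)).bind (gaussianChannel v) =
      Measure.pi fun _ => gaussianReal 0 1 := by
  rw [bind_gaussianChannel]
  congr 1
  ext1 j
  rw [tsub_add_cancel_of_le (hv j)]

-- The joint density is exactly the exponential of the test function of the lower bound. The
-- conditional variances equal `v j`, so the quadratic terms cancel.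
open InformationTheory in
theorem klDiv_gaussianChannel {d : ℕ} {v : Fin d → ℝ≥0} (hv0 : ∀ j, v j ≠ 0)
    (hv : ∀ j, v j ≤ 1) :
    klDiv ((Measure.pi fun j => gaussianReal 0 (1 - v j)).compProd (gaussianChannel v))
      ((Measure.pi fun j => gaussianReal 0 (1 - v j)).prod
        (Measure.pi fun _ : Fin d => gaussianReal 0 1)) =
      ENNReal.ofReal (∑ j, -(Real.log (v j)) / 2) := by
  set ν : Measure (Fin d → ℝ) := Measure.pi fun j => gaussianReal 0 (1 - v j)
  set γ : Measure (Fin d → ℝ) := Measure.pi fun _ : Fin d => gaussianReal 0 1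
  have hbind : ν.bind (gaussianChannel v) = γ := bind_gaussianChannel_standard hv
  have hF : Measurable fun p : (Fin d → ℝ) × (Fin d → ℝ) =>
      piGaussianLogRatio (fun j => (v j : ℝ)) p.1 p.2 := by fun_prop
  have hmean : ∀ (u : Fin d → ℝ) j, ∫ y : Fin d → ℝ, y j ∂gaussianChannel v u = u j := by
    intro u j
    have h := (measurePreserving_eval (fun j => gaussianReal (u j) (v j)) j).map_eq
    rw [gaussianChannel_apply]
    have h2 := integral_map (μ := Measure.pi fun j => gaussianReal (u j) (v j))
      (φ := Function.eval j) (f := fun x : ℝ => x) (measurable_pi_apply j).aemeasurable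
      measurable_id.aestronglyMeasurable
    refine h2.symm.trans ?_
    rw [h]
    simp
  have hvar : ∀ (u : Fin d → ℝ) j, Var[fun y : Fin d → ℝ => y j; gaussianChannel v u] = v j := by
    intro u j
    have h := (measurePreserving_eval (fun j => gaussianReal (u j) (v j)) j).variance_fun_comp
      (f := id) (by fun_prop)
    rw [variance_id_gaussianReal] at h
    exact h
  have hmap : γ.map id = Measure.pi fun _ => gaussianReal 0 1 := Measure.map_id
  have hdens : ν.compProd (gaussianChannel v) = (ν.prod γ).withDensity fun p =>
      ENNReal.ofReal (Real.exp (piGaussianLogRatio (fun j => (v j : ℝ)) p.1 p.2)) := by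
    have hk : gaussianChannel v = (Kernel.const (Fin d → ℝ) γ).withDensity fun u x =>
        ENNReal.ofReal (Real.exp (piGaussianLogRatio (fun j => (v j : ℝ)) u x)) := by
      ext1 u
      rw [Kernel.withDensity_apply _ hF.exp.ennreal_ofReal, Kernel.const_apply,
        gaussianChannel_apply, pi_gaussianReal_eq_withDensity u hv0]
    have : IsSFiniteKernel ((Kernel.const (Fin d → ℝ) γ).withDensity fun u x =>
        ENNReal.ofReal (Real.exp (piGaussianLogRatio (fun j => (v j : ℝ)) u x))) := by
      rw [← hk]; infer_instance
    rw [hk, Measure.compProd_withDensity hF.exp.ennreal_ofReal, Measure.compProd_const]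
  have hint := integrable_piGaussianLogRatio hbind (fun j => (v j : ℝ)) measurable_id
    (memLp_of_map_eq measurable_id hmap)
  have hval := integral_piGaussianLogRatio hbind (fun j => (v j : ℝ)) measurable_id
    (memLp_of_map_eq measurable_id hmap)
  simp only [id, hmean] at hint hval
  have hP : IsProbabilityMeasure ((ν.prod γ).withDensity fun p =>
      ENNReal.ofReal (Real.exp (piGaussianLogRatio (fun j => (v j : ℝ)) p.1 p.2))) := by
    rw [← hdens]; infer_instance
  rw [hdens] at hint hval ⊢
  rw [klDiv_withDensity_exp _ hF hint, hval]
  congr 1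
  refine Finset.sum_congr rfl fun j _ => ?_
  have h1 := integral_sq_of_map_eq measurable_id hmap j
  simp only [id] at h1
  have hvj : (v j : ℝ) ≠ 0 := by exact_mod_cast hv0 j
  rw [h1]
  simp only [hvar]
  rw [integral_const, probReal_univ, one_smul]
  field_simp
  ring

-- Under this law the covariance matrix is `T diag(v) Tᵀ`; for a Gaussian vector, vanishing
-- off-diagonal covariances mean independence.
open Matrix in
theorem iIndepFun_map_unwhiten {m d : ℕ} (T : Matrix (Fin m) (Fin d) ℝ) (c : Fin m → ℝ)
    (u : Fin d → ℝ) (v : Fin d → ℝ≥0) (hL : (T * diagonal (fun j => (v j : ℝ)) * Tᵀ).IsDiag) :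
    iIndepFun (fun (i : Fin m) (x : Fin m → ℝ) => x i)
      ((gaussianChannel v u).map fun w => c + T *ᵥ w) := by
  set ρ := gaussianChannel v u with hρ
  have hcoord : iIndepFun (fun j (w : Fin d → ℝ) => w j) ρ :=
    iIndepFun_pi (X := fun _ x => x) fun j => aemeasurable_id
  have hev := fun j => measurePreserving_eval (fun j => gaussianReal (u j) (v j)) j
  have hG : HasGaussianLaw (fun w : Fin d → ℝ => w) ρ := by
    refine iIndepFun.hasGaussianLaw (X := fun j (w : Fin d → ℝ) => w j) (fun j => ⟨?_⟩) hcoord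
    have h := (hev j).map_eq
    change IsGaussian (ρ.map (Function.eval j))
    rw [hρ, gaussianChannel_apply, h]
    infer_instance
  have hL2 : ∀ j, MemLp (fun w : Fin d → ℝ => w j) 2 ρ := fun j =>
    (HasGaussianLaw.eval (X := fun j (w : Fin d → ℝ) => w j) hG j).memLp_two
  have hcov : ∀ j k, diagonal (fun j => (v j : ℝ)) j k =
      cov[fun w : Fin d → ℝ => w j, fun w => w k; ρ] := by
    intro j k
    by_cases hjk : j = k
    · subst hjk
      rw [diagonal_apply_eq, covariance_self (measurable_pi_apply j).aemeasurable]
      have h := (hev j).variance_fun_comp (f := id) (by fun_prop)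
      rw [variance_id_gaussianReal] at h
      exact h.symm
    · rw [diagonal_apply_ne _ hjk, (hcoord.indepFun hjk).covariance_eq_zero (hL2 j) (hL2 k)]
  have hT : HasGaussianLaw (fun w : Fin d → ℝ => fun i => (T *ᵥ w) i) ρ :=
    hG.map_fun (LinearMap.toContinuousLinearMap T.mulVecLin)
  have hind : iIndepFun (fun i (w : Fin d → ℝ) => (T *ᵥ w) i) ρ := by
    refine hT.iIndepFun_of_covariance_eq_zero fun i k hik => ?_
    have := covariance_dotProduct hL2 hcov (T i) (T k)
    change cov[fun w => T i ⬝ᵥ w, fun w => T k ⬝ᵥ w; ρ] = 0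
    rw [this]
    have h := hL hik
    rw [Matrix.mul_assoc] at h
    exact h
  have hind2 : iIndepFun (fun i (w : Fin d → ℝ) => (c + T *ᵥ w) i) ρ :=
    hind.comp (fun i y => c i + y) fun i => measurable_const_add (c i)
  have hmeas := measurable_unwhiten T c
  have hmi : ∀ i, Measurable fun w : Fin d → ℝ => (c + T *ᵥ w) i := fun i =>
    (measurable_pi_apply i).comp hmeas
  have : IsProbabilityMeasure (ρ.map fun w => c + T *ᵥ w) :=
    Measure.isProbabilityMeasure_map hmeas.aemeasurable
  rw [iIndepFun_iff_map_fun_eq_pi_map fun i => (measurable_pi_apply i).aemeasurable]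
  have h1 := hind2.map_fun_eq_pi_map fun i => (hmi i).aemeasurable
  change ((ρ.map fun w => c + T *ᵥ w).map id) = _
  rw [Measure.map_id]
  refine h1.trans ?_
  congr 1
  ext1 i
  rw [Measure.map_map (measurable_pi_apply i) hmeas]
  rfl

open Matrix InformationTheory in
/-- A diagonal covariance matrix below `S` is attained by the additive decomposition of the Gaussian
vector into a Gaussian signal and an independent Gaussian noise with independent coordinates. -/
theorem commonInformation_le {m d : ℕ} (Q : Measure (Fin m → ℝ)) [IsGaussian Q]
    {S : Matrix (Fin m) (Fin m) ℝ} (hS : ∀ i j, S i j = cov[fun x => x i, fun x => x j; Q])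
    {A T : Matrix (Fin m) (Fin d) ℝ} {v : Fin d → ℝ≥0} (hA : Aᵀ * T = 1) (hST : S = T * Tᵀ)
    (hL : (T * diagonal (fun j => (v j : ℝ)) * Tᵀ).IsDiag) (hv0 : ∀ j, v j ≠ 0)
    (hv : ∀ j, v j ≤ 1) :
    commonInformation Q ≤ ENNReal.ofReal (∑ j, -(Real.log (v j)) / 2) := by
  set ν : Measure (Fin d → ℝ) := Measure.pi fun j => gaussianReal 0 (1 - v j)
  have hφ := measurable_unwhiten T (meanVec Q)
  set η : Kernel (Fin d → ℝ) (Fin m → ℝ) := (gaussianChannel v).map fun w => meanVec Q + T *ᵥ w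
    with hη
  have : IsMarkovKernel η := Kernel.IsMarkovKernel.map _ hφ
  have hηQ : ν.bind η = Q := by
    rw [hη, ← Measure.map_comp _ _ hφ, bind_gaussianChannel_standard hv, map_unwhiten Q hS hA hST]
  have hback : Q.bind (posterior η ν) = ν := by
    have h : (ν.bind η).bind (posterior η ν) = ν := posterior_comp_self
    rwa [hηQ] at h
  -- The decomposition gives `η = P_{X|U}`, whereas a channel `P_{U|X}` is needed: it is the
  -- posterior of `η`, and its own posterior is `η` again almost everywhere.
  have hpost : posterior (posterior η ν) Q =ᵐ[ν] η := by
    have := posterior_posterior (κ := η) (μ := ν)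
    simpa only [hηQ] using this
  have hci : CondIndepCoords Q (posterior η ν) := by
    rw [CondIndepCoords, hback]
    filter_upwards [hpost] with u hu
    rw [hu, hη, Kernel.map_apply _ hφ]
    exact iIndepFun_map_unwhiten T _ u v hL
  have hle : commonInformation Q ≤ mutualInformation Q (posterior η ν) :=
    iInf_le_of_le (Fin d → ℝ) <| iInf_le_of_le MeasurableSpace.pi <|
      iInf_le_of_le (posterior η ν) <| iInf_le_of_le
        (inferInstance : IsMarkovKernel (posterior η ν)) <| iInf_le _ hci
  refine hle.trans ?_
  have h1 : Q.compProd (posterior η ν) = (ν.compProd η).map Prod.swap := by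
    have := compProd_posterior_eq_map_swap (κ := η) (μ := ν)
    rwa [hηQ] at this
  rw [mutualInformation, hback, h1, ← Measure.prod_swap]
  refine (klDiv_map_le _ _ measurable_swap).trans ?_
  -- Both arguments of the divergence are images under `(u, w) ↦ (u, EX + T w)`, so data processing
  -- reduces the bound to `I(U; W)`.
  have h2 : ν.prod Q = (ν.prod (Measure.pi fun _ : Fin d => gaussianReal 0 1)).map
      (Prod.map id fun w => meanVec Q + T *ᵥ w) := by
    rw [← Measure.map_prod_map _ _ measurable_id hφ, Measure.map_id, map_unwhiten Q hS hA hST]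
  rw [h2, hη, Measure.compProd_map hφ, ← klDiv_gaussianChannel hv0 hv]
  exact klDiv_map_le _ _ (by fun_prop)

/-! ### Comparison of the two sides and the invertible case. -/

open Matrix in
/-- Every channel that makes the coordinates conditionally independent has at least the mutual
information of some diagonal matrix below the covariance matrix. -/
theorem exists_half_log_le_mutualInformation {m : ℕ} (Q : Measure (Fin m → ℝ)) [IsGaussian Q]
    {S : Matrix (Fin m) (Fin m) ℝ} (hS : ∀ i j, S i j = cov[fun x => x i, fun x => x j; Q])
    {β : Type*} [MeasurableSpace β] (κ : Kernel (Fin m → ℝ) β) [IsMarkovKernel κ]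
    (hκ : CondIndepCoords Q κ) :
    ∃ L ∈ diagonalBelow S, ∀ (d : ℕ) (A T : Matrix (Fin m) (Fin d) ℝ) (l : Fin d → ℝ),
      Aᵀ * T = 1 → S = T * Tᵀ → L = T * diagonal l * Tᵀ → (∀ j, 0 ≤ l j) →
      ((1 / 2 : ℝ) : EReal) * ENNReal.log (∏ j, ENNReal.ofReal (l j))⁻¹ ≤
        mutualInformation Q κ := by
  have hbind : (Q.bind κ).bind (posterior κ Q) = Q := posterior_comp_self
  obtain ⟨L, hL, hvar⟩ := exists_mem_diagonalBelow hbind (IsGaussian.memLp_eval Q) hS hκ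
  -- The whitening comes after `L`, since its coordinates must diagonalize `L`, which depends on the
  -- channel.
  refine ⟨L, hL, fun d A T l hA hST hLT hl => half_log_inv_prod_le hl fun v hv => ?_⟩
  have hA' : Tᵀ * A = 1 := by
    rw [← transpose_one, ← hA, transpose_mul, transpose_transpose]
  have hASA : Aᵀ * S * A = 1 := by
    rw [hST, ← Matrix.mul_assoc, hA, Matrix.one_mul, hA']
  have hALA : Aᵀ * L * A = diagonal l := by
    rw [hLT, Matrix.mul_assoc, Matrix.mul_assoc, Matrix.mul_assoc, hA', ← Matrix.mul_assoc, hA,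
      Matrix.one_mul, Matrix.mul_one]
  refine (ofReal_sum_le_klDiv_compProd hbind (measurable_whiten A (meanVec Q))
    (map_whiten Q hS hASA) (fun j => ?_) fun j => ?_).trans
    (klDiv_posterior_le_mutualInformation Q κ)
  · exact fun h => absurd (hv j) (by simp [h, hl j])
  · have h1 : ∀ u, Var[fun x => (Aᵀ *ᵥ (x - meanVec Q)) j; posterior κ Q u] =
        Var[fun x => A.col j ⬝ᵥ x; posterior κ Q u] := by
      intro u
      have hrw : (fun x : Fin m → ℝ => (Aᵀ *ᵥ (x - meanVec Q)) j) =
          fun x => A.col j ⬝ᵥ x - A.col j ⬝ᵥ meanVec Q := by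
        ext x
        rw [← dotProduct_sub]; rfl
      have hm : Measurable fun x : Fin m → ℝ => A.col j ⬝ᵥ x := by
        unfold dotProduct
        fun_prop
      rw [hrw, variance_sub_const hm.aestronglyMeasurable]
    have h2 : A.col j ⬝ᵥ L *ᵥ A.col j = l j := by
      have := congrFun (congrFun hALA j) j
      rw [diagonal_apply_eq, Matrix.mul_assoc] at this
      exact this
    simp only [h1]
    rw [hvar, h2]
    exact (hv j).le

/-- If some `l j = 0`, both sides are `∞`, in accordance with `log (a / 0) = +∞`. -/
theorem logDetRatio_eq {d : ℕ} {s t : ℝ} {l : Fin d → ℝ} (hs : 0 < s) (hl : ∀ j, 0 ≤ l j)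
    (ht : t = s * ∏ j, l j) :
    ENNReal.ofReal s / ENNReal.ofReal t = (∏ j, ENNReal.ofReal (l j))⁻¹ := by
  have hs' : ENNReal.ofReal s ≠ 0 := by simpa using hs
  rw [ht, ENNReal.ofReal_mul hs.le, ENNReal.ofReal_prod_of_nonneg fun j _ => hl j,
    div_eq_mul_inv, ENNReal.mul_inv (Or.inl hs') (Or.inl ENNReal.ofReal_ne_top), ← mul_assoc,
    ENNReal.mul_inv_cancel hs' ENNReal.ofReal_ne_top, one_mul]

open Matrix in
/-- The common information of a Gaussian vector, invertible covariance or not. -/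
theorem commonInformation_eq {m : ℕ} (Q : Measure (Fin m → ℝ)) [IsGaussian Q]
    {S : Matrix (Fin m) (Fin m) ℝ} (hS : ∀ i j, S i j = cov[fun x => x i, fun x => x j; Q]) :
    (commonInformation Q : EReal) = ((1 / 2 : ℝ) : EReal) * ⨅ L ∈ diagonalBelow S,
      ENNReal.log (ENNReal.ofReal (LinearMap.det (restrictTo (columnSpace S) S)) /
        ENNReal.ofReal (LinearMap.det (restrictTo (columnSpace S) L))) := by
  have hpsd := posSemidef_of_covariance (IsGaussian.memLp_eval Q) hS
  have hhalf : ∀ a b : EReal, a ≤ b → ((1 / 2 : ℝ) : EReal) * a ≤ ((1 / 2 : ℝ) : EReal) * b :=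
    fun a b hab => mul_le_mul_of_nonneg_left hab (by exact_mod_cast (by norm_num : (0 : ℝ) ≤ 1 / 2))
  have htwo : ∀ a b : EReal, a ≤ ((1 / 2 : ℝ) : EReal) * b → ((2 : ℝ) : EReal) * a ≤ b := by
    intro a b hab
    refine (mul_le_mul_of_nonneg_left hab
      (by exact_mod_cast (by norm_num : (0 : ℝ) ≤ 2) : (0 : EReal) ≤ ((2 : ℝ) : EReal))).trans ?_
    rw [← mul_assoc, ← EReal.coe_mul]
    norm_num
  apply le_antisymm
  · have h : ((2 : ℝ) : EReal) * (commonInformation Q : EReal) ≤ ⨅ L ∈ diagonalBelow S,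
        ENNReal.log (ENNReal.ofReal (LinearMap.det (restrictTo (columnSpace S) S)) /
          ENNReal.ofReal (LinearMap.det (restrictTo (columnSpace S) L))) := by
      refine le_iInf₂ fun L hL => ?_
      obtain ⟨d, A, T, l, hA, hST, hLT, hl0, hl1, hdet, hdet'⟩ := exists_whitening hpsd hL
      rw [logDetRatio_eq hdet hl0 hdet']
      by_cases hz : ∃ j, l j = 0
      · obtain ⟨j, hj⟩ := hz
        rw [Finset.prod_eq_zero (Finset.mem_univ j) (by simp [hj])]
        simp
      push Not at hz
      have hpos : ∀ j, 0 < l j := fun j => (hl0 j).lt_of_ne' (hz j)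
      refine htwo _ _ ?_
      rw [half_log_inv_prod hpos]
      have h1 := commonInformation_le Q hS (v := fun j => ⟨l j, hl0 j⟩) hA hST
        (by rw [hLT] at hL; exact hL.1) (fun j hj => hz j (congrArg NNReal.toReal hj)) hl1
      refine (EReal.coe_ennreal_le_coe_ennreal_iff.2 h1).trans ?_
      rw [EReal.coe_ennreal_ofReal]
      refine EReal.coe_le_coe_iff.2 (max_le le_rfl (Finset.sum_nonneg fun j _ => ?_))
      have := Real.log_nonpos (hl0 j) (hl1 j)
      change 0 ≤ -Real.log (l j) / 2
      linarith
    have h2 := hhalf _ _ h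
    rw [← mul_assoc, ← EReal.coe_mul] at h2
    norm_num at h2 ⊢
    exact h2
  · have key : ∀ (β : Type) (_ : MeasurableSpace β) (κ : Kernel (Fin m → ℝ) β)
        (_ : IsMarkovKernel κ) (_ : CondIndepCoords Q κ),
        ((1 / 2 : ℝ) : EReal) * (⨅ L ∈ diagonalBelow S,
          ENNReal.log (ENNReal.ofReal (LinearMap.det (restrictTo (columnSpace S) S)) /
            ENNReal.ofReal (LinearMap.det (restrictTo (columnSpace S) L)))) ≤
          (mutualInformation Q κ : EReal) := by
      intro β _ κ _ hκ
      obtain ⟨L, hL, hle⟩ := exists_half_log_le_mutualInformation Q hS κ hκ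
      obtain ⟨d, A, T, l, hA, hST, hLT, hl0, hl1, hdet, hdet'⟩ := exists_whitening hpsd hL
      refine le_trans (hhalf _ _ (iInf₂_le L hL)) ?_
      rw [logDetRatio_eq hdet hl0 hdet']
      exact hle d A T l hA hST hLT hl0
    -- The infimum in `commonInformation` is taken in `[0, ∞]`, so the left side is first moved
    -- there by `EReal.toENNReal`, which truncates at 0.
    refine ((le_max_right _ _).trans EReal.coe_toENNReal_eq_max.ge).trans (EReal.coe_ennreal_le_coe_ennreal_iff.2 ?_)
    refine le_iInf fun β => le_iInf fun hβ => le_iInf fun κ => le_iInf fun hκ => le_iInf fun hci => ?_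
    simpa using EReal.toENNReal_le_toENNReal (key β hβ κ hκ hci)

open Matrix in
theorem columnSpace_eq_top {m : ℕ} {S : Matrix (Fin m) (Fin m) ℝ} (hS : S.PosDef) :
    columnSpace S = ⊤ := by
  refine LinearMap.range_eq_top.2 (LinearMap.injective_iff_surjective.1 fun x y hxy => ?_)
  have h := congrArg WithLp.ofLp hxy
  simp only [toLpLin_apply] at h
  exact WithLp.ofLp_injective _ (mulVec_injective_of_isUnit hS.isUnit h)

open Matrix in
theorem det_restrictTo_top {m : ℕ} (A : Matrix (Fin m) (Fin m) ℝ) :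
    LinearMap.det (restrictTo ⊤ A) = A.det := by
  have h : restrictTo ⊤ A = Submodule.topEquiv.symm.toLinearMap ∘ₗ toEuclideanLin A ∘ₗ
      Submodule.topEquiv.toLinearMap := by
    ext1 v
    apply Subtype.ext
    rw [coe_restrictTo _ _ _ Submodule.mem_top]
    rfl
  rw [h]
  have h2 := LinearMap.det_conj (toEuclideanLin A)
    (Submodule.topEquiv (R := ℝ) (M := EuclideanSpace ℝ (Fin m))).symm
  rw [LinearEquiv.symm_symm] at h2
  rw [h2, toEuclideanLin_eq_toLin_orthonormal, LinearMap.det_toLin]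

theorem theorem10 {Ω : Type*} [MeasurableSpace Ω] (P : Measure Ω) [IsProbabilityMeasure P]
    {m : ℕ} (X : Fin m → Ω → ℝ) (hX : HasGaussianLaw (fun ω i => X i ω) P)
    (S : Matrix (Fin m) (Fin m) ℝ) (hS : ∀ i j, S i j = covariance (X i) (X j) P) :
    (S.PosDef →
      (commonInformation (P.map (fun ω i => X i ω)) : EReal) =
        ((1 / 2 : ℝ) : EReal) * ⨅ L ∈ diagonalBelow S,
          ENNReal.log (ENNReal.ofReal S.det / ENNReal.ofReal L.det)) ∧
    (commonInformation (P.map (fun ω i => X i ω)) : EReal) =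
      ((1 / 2 : ℝ) : EReal) * ⨅ L ∈ diagonalBelow S,
        ENNReal.log (ENNReal.ofReal (LinearMap.det (restrictTo (columnSpace S) S)) /
          ENNReal.ofReal (LinearMap.det (restrictTo (columnSpace S) L))) := by
  have hXm := hX.aemeasurable
  have hQ : IsGaussian (P.map fun ω i => X i ω) := hX.isGaussian_map
  have hcov : ∀ i j, S i j =
      covariance (fun x : Fin m → ℝ => x i) (fun x => x j) (P.map fun ω i => X i ω) := by
    intro i j
    rw [hS, covariance_map_fun (measurable_pi_apply i).aestronglyMeasurable
      (measurable_pi_apply j).aestronglyMeasurable hXm]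
  have hmain := commonInformation_eq (P.map fun ω i => X i ω) hcov
  refine ⟨fun hpd => ?_, hmain⟩
  rw [hmain, columnSpace_eq_top hpd]
  simp only [det_restrictTo_top]
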